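/- A \emph{parallelogram polyomino} is, up to translation, the set of unit cells of $\mathbb Z\times\mathbb Z$ between two lattice paths with North and East unit steps that have the same starting point and the same end point and meet only at these two points. A \emph{periodic parallelogram polyomino} (PPP) is a parallelogram polyomino $P$ together with an integer $g\ge 1$, its \emph{gluing size}, that is at most the number of cells of the first (leftmost) column and at most the number of cells of the last (rightmost) column; rectangles whose gluing size equals the size of their columns are excluded. The $g$ top cells of the last column are glued, in order, to the $g$ bottom cells of the first column, and rows glued together are counted as the same row. The \emph{width} of $P$ is its number of columns, its \emph{height} is its number of rows counted up to gluing (the total number of rows of the polyomino minus $g$), and its \emph{semi-perimeter} is the sum of its width and its height. The graph $\varphi(P)$ has one vertex for each column, placed in the top cell of the column, and one vertex for each row (up to gluing), placed in the rightmost cell of the row; the parent of a column vertex is the vertex of the row that contains its cell, and the parent of a row vertex is the vertex of the column that contains its cell. Recursively deleting the columns and rows that correspond to leaves (vertices without children) yields a PPP called the \emph{trunk} of $P$. The \emph{intrinsic thickness} of $P$ is the gluing size of its trunk, and $P$ is \emph{primitive} if its intrinsic thickness is at most the width of its trunk. \textbf{Theorem.} For every integer $n\ge 0$, the number of primitive PPP's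 with semi-perimeter $n+2$ is finite and equals $$\frac{(2n+1)!}{(n!)^2}.$$ The generating series of primitive PPP's by semi-perimeter $sp$ is, as a formal power series, $$\sum_{P\ \text{primitive PPP}} z^{sp(P)} = z^2(1-4z)^{-3/2}.$$ -/

import Mathlib

/-- A parallelogram polyomino, translated so that its lower left corner is the origin: the region
between two lattice paths with North and East unit steps, from `(0, 0)` to `(width, rows)`, that
meet only at their two end points.

A North-East path with these end points is recorded by the heights of its East steps: `lower x`
and `upper x` are the heights of the East steps of the lower and of the upper path above the
interval `[x, x + 1]`.  These heights are weakly increasing and bounded by `rows`.  The lower path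
visits exactly the points `(x, y)` with `lower (x - 1) ≤ y ≤ lower x` (where `lower (-1)` is read
as `0` and `lower width` as `rows`), and similarly for the upper path.  Hence the two paths, the
second above the first, meet only at the end points iff the lower path starts with an East step
(`lower_first`), the upper path ends with an East step (`upper_last`), and, on each vertical line
strictly between, the lower path lies strictly below the upper one (`lower_lt_upper` with
`j = i + 1`); the case `j = i` says that every column has a cell. -/
structure ParallelogramPolyomino where
  /-- number of columns -/
  width : ℕ
  /-- number of rows of the (planar) polyomino -/
  rows : ℕ
  /-- heights of the East steps of the lower path -/
  lower : Fin width → ℕ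
  /-- heights of the East steps of the upper path -/
  upper : Fin width → ℕ
  width_pos : 0 < width
  lower_mono : Monotone lower
  upper_mono : Monotone upper
  lower_first : lower ⟨0, width_pos⟩ = 0
  upper_last : upper ⟨width - 1, Nat.sub_lt width_pos Nat.one_pos⟩ = rows
  lower_lt_upper : ∀ i j : Fin width, (j : ℕ) ≤ i + 1 → lower j < upper i

namespace ParallelogramPolyomino

variable (P : ParallelogramPolyomino)

/-- The first (leftmost) column. -/
def firstCol : Fin P.width := ⟨0, P.width_pos⟩

/-- The last (rightmost) column. -/
def lastCol : Fin P.width := ⟨P.width - 1, Nat.sub_lt P.width_pos Nat.one_pos⟩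

/-- The unit cell in column `x` and row `y` (both numbered from `0`, rows from bottom to top)
belongs to the polyomino. -/
def IsCell (x : Fin P.width) (y : ℕ) : Prop := P.lower x ≤ y ∧ y < P.upper x

/-- The number of cells of a column. -/
def colHeight (x : Fin P.width) : ℕ := P.upper x - P.lower x

/-- The polyomino is a rectangle. -/
def IsRectangle : Prop := ∀ x, P.colHeight x = P.rows

end ParallelogramPolyomino

/-- A periodic parallelogram polyomino (PPP): a parallelogram polyomino with a gluing size `g`,
`1 ≤ g ≤` the heights of the first and of the last column; rectangles whose gluing size
is the size of the columns are excluded.  The `g` top cells of the last column are glued, in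
order, to the `g` bottom cells of the first column. -/
structure PPP extends ParallelogramPolyomino where
  /-- the gluing size -/
  gluing : ℕ
  gluing_pos : 0 < gluing
  gluing_le_first : gluing ≤ toParallelogramPolyomino.colHeight toParallelogramPolyomino.firstCol
  gluing_le_last : gluing ≤ toParallelogramPolyomino.colHeight toParallelogramPolyomino.lastCol
  not_degenerate : ¬ (toParallelogramPolyomino.IsRectangle ∧ gluing = rows)

namespace PPP

/-- The height of a PPP: the number of rows strictly below the marking of the last column, i.e.
the number of rows once rows glued together are counted as one row. -/
def height (P : PPP) : ℕ := P.rows - P.gluing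

/-- The semi-perimeter of a PPP. -/
def semiPerimeter (P : PPP) : ℕ := P.width + P.height

/-- The vertices of the graph of a PPP: one for each column and one for each row, where rows that
are glued together count as the same row.  The gluing identifies row `y + height` with row `y`
for `y < gluing`, so the rows of the PPP are represented by `0, …, height - 1`, and the planar row
`j` is part of the row `j % height` of the PPP. -/
inductive Vertex (P : PPP) : Type
  | col (x : Fin P.width) : Vertex P
  | row (y : Fin P.height) : Vertex P

/-- `P.IsParent u v`: `u` is the parent of `v` in the graph of `P`.

The column vertex `x` sits in the top cell of column `x`, and its parent is the vertex of the row
containing this cell.  The row vertex `y` sits in the rightmost cell of row `y`, and its parent is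
the vertex of the column containing this cell.  (A planar row `j ≥ height` reaches the marked
part of the last column and continues to the right in the planar row `j - height`; so the
rightmost cell of the row `y < height` is the last cell of the planar row `y` itself.) -/
def IsParent (P : PPP) : Vertex P → Vertex P → Prop
  | .row y, .col x => (P.upper x - 1) % P.height = y
  | .col x, .row y => P.IsCell x y ∧ ∀ x' : Fin P.width, x < x' → ¬ P.IsCell x' y
  | _, _ => False

/-- The vertices left after `m` rounds of removal of the leaves (the vertices without children).
A leaf is the parent of no remaining vertex, so deleting the column or the row of
a leaf changes neither the other vertices nor their parents. -/
def pruned (P : PPP) : ℕ → Set (Vertex P)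
  | 0 => Set.univ
  | m + 1 => {u | u ∈ P.pruned m ∧ ∃ v ∈ P.pruned m, P.IsParent u v}

/-- The vertices that are never removed. -/
def core (P : PPP) : Set (Vertex P) := ⋂ m, P.pruned m

/-- `T.IsTrunkOf P`: the PPP `T` is the trunk of `P`, i.e. `T` is what remains of `P` when all the
columns and rows that correspond to recursively removed leaves are deleted.  The maps `c` and `r`
list, in increasing order, the remaining columns and the remaining planar rows (those that
belong to a remaining row of the PPP and still contain a cell); the cells of `T` are the cells of
`P` at the remaining places, and the rows of the PPP `T`, counted up to gluing, are the
remaining rows of the PPP `P` (this determines the gluing size of `T`). -/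
def IsTrunkOf (T P : PPP) : Prop :=
  (∃ (c : Fin T.width → Fin P.width) (r : Fin T.rows → Fin P.rows),
    StrictMono c ∧ StrictMono r ∧
    Set.range c = {x | Vertex.col x ∈ P.core} ∧
    Set.range r = {j : Fin P.rows | (∃ y : Fin P.height, (j : ℕ) % P.height = y ∧ Vertex.row y ∈ P.core) ∧
      ∃ x : Fin P.width, Vertex.col x ∈ P.core ∧ P.IsCell x j} ∧
    ∀ (x : Fin T.width) (j : Fin T.rows), T.IsCell x j ↔ P.IsCell (c x) (r j)) ∧
  T.height = {y : Fin P.height | Vertex.row y ∈ P.core}.ncard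

/-- A PPP is primitive if its intrinsic thickness, which is the gluing size of its trunk, is at
most the width of its trunk. -/
def IsPrimitive (P : PPP) : Prop := ∃ T : PPP, T.IsTrunkOf P ∧ T.gluing ≤ T.width

end PPP

/-! ### Bounds on a PPP, and its unrolling into a periodic strip. -/

namespace PPP

variable (P : PPP)

/-! Unrolling the gluing turns a PPP of width `w` and height `h` into an infinite strip between
monotone boundaries `L`, `U` (`liftLower`, `liftUpper`) that rise by `h` every `w` columns and
satisfy `L (x + 1) < U x`; these data determine the PPP. Two parent steps send the column `x` to `F
x`, the column where the row of its top cell ends. The map `F` is monotone and commutes with the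
shift by `w`.

The parent map sends the core onto itself, hence bijectively, so `F` is strictly increasing on core
columns and the trunk has as many rows (up to gluing) as columns. If `a` is the first core column,
the gluing size of the trunk counts the core columns in `[a, F a)`, while one period contains as
many core columns as the trunk has columns. So primitivity means `F a ≤ a + w`. Comparing orbits, as
for rotation numbers (`CoreCol.next_le_add_width`), this holds as soon as any column, core or not,
satisfies `F x ≤ x + w`, which says `U x ≤ L (x + 1) + h` (`isPrimitive_iff`).

It remains to count strips. The increments of `L` and `U` over a period are two weak compositions of
`h` into `w` parts; the only other parameter is `e = U 0`. If `M` is the largest value of `L (x + 1)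
- (U x - U 0)`, the strip condition says `M < e` and primitivity says `e ≤ M + h`: exactly `h`
choices, whatever the increments. This gives `h * (w + h - 1).choose h ^ 2`
(`ncard_isPrimitive_width_height`), and the sum over `w + h = n + 2` is a Vandermonde convolution.
-/

theorem lower_add_gluing_le_rows (x : Fin P.width) : P.lower x + P.gluing ≤ P.rows := by
  have h1 := P.gluing_le_last
  have h2 := P.upper_last
  have h3 := P.gluing_pos
  have h4 : P.lower x ≤ P.lower P.lastCol :=
    P.lower_mono (Fin.le_def.2 (Nat.le_sub_one_of_lt x.2))
  simp only [ParallelogramPolyomino.colHeight] at h1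
  simp only [ParallelogramPolyomino.lastCol] at *
  omega

theorem upper_le_rows (x : Fin P.width) : P.upper x ≤ P.rows := by
  rw [← P.upper_last]
  exact P.upper_mono (Fin.le_def.2 (Nat.le_sub_one_of_lt x.2))

theorem gluing_le_upper (x : Fin P.width) : P.gluing ≤ P.upper x := by
  have h1 := P.gluing_le_first
  have h2 : P.upper P.firstCol ≤ P.upper x := P.upper_mono (Fin.le_def.2 (Nat.zero_le _))
  simp only [ParallelogramPolyomino.colHeight] at h1
  omega

theorem height_add_gluing : P.height + P.gluing = P.rows := by
  have := P.lower_add_gluing_le_rows P.firstCol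
  simp only [height]
  omega

/-- This is where degenerate rectangles matter: if all rows were glued, the bounds above would force
every column to be full. -/
theorem height_pos : 0 < P.height := by
  by_contra h0
  have h1 := P.height_add_gluing
  refine P.not_degenerate ⟨fun x => ?_, by omega⟩
  have h2 := P.lower_add_gluing_le_rows x
  have h3 := P.gluing_le_upper x
  have h4 := P.upper_le_rows x
  simp only [ParallelogramPolyomino.colHeight]
  omega

/-- The lower boundary of the periodic strip obtained by unrolling a PPP. -/
def liftLower (x : ℕ) : ℕ :=
  P.lower ⟨x % P.width, Nat.mod_lt _ P.width_pos⟩ + P.height * (x / P.width)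

/-- The upper boundary of the periodic strip obtained by unrolling a PPP. -/
def liftUpper (x : ℕ) : ℕ :=
  P.upper ⟨x % P.width, Nat.mod_lt _ P.width_pos⟩ + P.height * (x / P.width)

theorem liftLower_mul_add (q : ℕ) (r : Fin P.width) :
    P.liftLower (P.width * q + r) = P.lower r + P.height * q := by
  have h1 : (P.width * q + r) % P.width = r := by
    rw [Nat.mul_add_mod, Nat.mod_eq_of_lt r.2]
  have h2 : (P.width * q + r) / P.width = q := by
    rw [Nat.mul_add_div P.width_pos, Nat.div_eq_of_lt r.2, add_zero]
  simp only [liftLower, h1, h2]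

theorem liftUpper_mul_add (q : ℕ) (r : Fin P.width) :
    P.liftUpper (P.width * q + r) = P.upper r + P.height * q := by
  have h1 : (P.width * q + r) % P.width = r := by
    rw [Nat.mul_add_mod, Nat.mod_eq_of_lt r.2]
  have h2 : (P.width * q + r) / P.width = q := by
    rw [Nat.mul_add_div P.width_pos, Nat.div_eq_of_lt r.2, add_zero]
  simp only [liftUpper, h1, h2]

theorem liftLower_coe (r : Fin P.width) : P.liftLower r = P.lower r := by
  simpa using P.liftLower_mul_add 0 r

theorem liftUpper_coe (r : Fin P.width) : P.liftUpper r = P.upper r := by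
  simpa using P.liftUpper_mul_add 0 r

theorem liftLower_add_width (x : ℕ) : P.liftLower (x + P.width) = P.liftLower x + P.height := by
  simp only [liftLower, Nat.add_mod_right, Nat.add_div_right _ P.width_pos]
  ring

theorem liftUpper_add_width (x : ℕ) : P.liftUpper (x + P.width) = P.liftUpper x + P.height := by
  simp only [liftUpper, Nat.add_mod_right, Nat.add_div_right _ P.width_pos]
  ring

theorem liftLower_zero : P.liftLower 0 = 0 := by
  have := P.liftLower_coe P.firstCol
  exact this.trans P.lower_first

theorem liftLower_width : P.liftLower P.width = P.height := by
  simpa [P.liftLower_zero] using P.liftLower_add_width 0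

/-- Every column of the strip is either a translate of a column having a right neighbour in the
polyomino, or a translate of the last column. -/
theorem exists_eq_mul_add (x : ℕ) :
    (∃ (q : ℕ) (r s : Fin P.width), (s : ℕ) = r + 1 ∧ x = P.width * q + r ∧
      x + 1 = P.width * q + s) ∨
    ∃ q : ℕ, x = P.width * q + P.lastCol ∧ x + 1 = P.width * (q + 1) + P.firstCol := by
  have h := Nat.div_add_mod x P.width
  have hlt := Nat.mod_lt x P.width_pos
  rcases Nat.lt_or_ge (x % P.width + 1) P.width with h1 | h1
  · exact .inl ⟨x / P.width, ⟨x % P.width, hlt⟩, ⟨x % P.width + 1, h1⟩, rfl, h.symm, by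
      change x + 1 = P.width * (x / P.width) + (x % P.width + 1)
      omega⟩
  · refine .inr ⟨x / P.width, ?_, ?_⟩
    · change x = P.width * (x / P.width) + (P.width - 1)
      omega
    · change x + 1 = P.width * (x / P.width + 1) + 0
      rw [mul_add]
      omega

theorem liftLower_mono : Monotone P.liftLower := by
  refine monotone_nat_of_le_succ fun x => ?_
  rcases P.exists_eq_mul_add x with ⟨q, r, s, hs, h1, h2⟩ | ⟨q, h1, h2⟩
  · rw [h2, h1, liftLower_mul_add, liftLower_mul_add]
    have := P.lower_mono (show r ≤ s from Fin.le_def.2 (by omega))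
    omega
  · rw [h2, h1, liftLower_mul_add, liftLower_mul_add]
    have := P.lower_add_gluing_le_rows P.lastCol
    have := P.height_add_gluing
    rw [mul_add]
    omega

theorem liftUpper_mono : Monotone P.liftUpper := by
  refine monotone_nat_of_le_succ fun x => ?_
  rcases P.exists_eq_mul_add x with ⟨q, r, s, hs, h1, h2⟩ | ⟨q, h1, h2⟩
  · rw [h2, h1, liftUpper_mul_add, liftUpper_mul_add]
    have := P.upper_mono (show r ≤ s from Fin.le_def.2 (by omega))
    omega
  · rw [h2, h1, liftUpper_mul_add, liftUpper_mul_add]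
    have := P.upper_le_rows P.lastCol
    have := P.height_add_gluing
    have := P.gluing_le_upper P.firstCol
    rw [mul_add]
    omega

/-- Inside a period this is `lower_lt_upper`; across the seam it amounts to `height < rows`, that
is, to the gluing size being positive. -/
theorem liftLower_succ_lt (x : ℕ) : P.liftLower (x + 1) < P.liftUpper x := by
  rcases P.exists_eq_mul_add x with ⟨q, r, s, hs, h1, h2⟩ | ⟨q, h1, h2⟩
  · rw [h2, h1, liftLower_mul_add, liftUpper_mul_add]
    have := P.lower_lt_upper r s hs.le
    omega
  · rw [h2, h1, liftLower_mul_add, liftUpper_mul_add]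
    have h3 := P.upper_last
    have h4 := P.lower_first
    have := P.height_add_gluing
    have := P.gluing_pos
    simp only [ParallelogramPolyomino.lastCol, ParallelogramPolyomino.firstCol]
    rw [mul_add]
    omega

/-! ### Tops of columns and ends of rows in the strip. -/

/-- The row of the top cell of a column of the strip. -/
def colTop (x : ℕ) : ℕ := P.liftUpper x - 1

theorem colTop_add_one (x : ℕ) : P.colTop x + 1 = P.liftUpper x := by
  have := P.liftLower_succ_lt x
  simp only [colTop]
  omega

theorem colTop_mono : Monotone P.colTop := fun _ _ h => Nat.sub_le_sub_right (P.liftUpper_mono h) 1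

theorem colTop_add_width (x : ℕ) : P.colTop (x + P.width) = P.colTop x + P.height := by
  have h1 := P.colTop_add_one x
  have h2 := P.colTop_add_one (x + P.width)
  rw [liftUpper_add_width] at h2
  omega

/-- The column of the rightmost cell of a row of the strip. -/
def rowEnd (y : ℕ) : ℕ := Nat.findGreatest (fun x => P.liftLower x ≤ y) (P.width * (y + 1))

/-- A Galois connection with the lower boundary. The search bound in `rowEnd` suffices because the
lower boundary rises by at least one per period. -/
theorem le_rowEnd_iff {x y : ℕ} : x ≤ P.rowEnd y ↔ P.liftLower x ≤ y := by
  refine ⟨fun h => (P.liftLower_mono h).trans ?_, fun h => Nat.le_findGreatest ?_ h⟩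
  · exact Nat.findGreatest_spec (P := fun x => P.liftLower x ≤ y) (Nat.zero_le _)
      (P.liftLower_zero.trans_le (Nat.zero_le _))
  · have h1 : P.height * (x / P.width) ≤ y := (Nat.le_add_left _ _).trans h
    have h2 : x / P.width ≤ y := (Nat.le_mul_of_pos_left _ P.height_pos).trans h1
    have h3 := (Nat.div_lt_iff_lt_mul P.width_pos).1 (Nat.lt_succ_of_le h2)
    rw [mul_comm]
    exact h3.le

theorem rowEnd_lt_iff {x y : ℕ} : P.rowEnd y < x ↔ y < P.liftLower x := by
  rw [← not_le, le_rowEnd_iff, not_le]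

theorem rowEnd_mono : Monotone P.rowEnd := fun _ _ h =>
  P.le_rowEnd_iff.2 ((P.le_rowEnd_iff.1 le_rfl).trans h)

theorem rowEnd_add_height (y : ℕ) : P.rowEnd (y + P.height) = P.rowEnd y + P.width := by
  refine eq_of_forall_le_iff fun x => ?_
  rw [le_rowEnd_iff]
  rcases le_total P.width x with h | h
  · obtain ⟨z, rfl⟩ := Nat.exists_eq_add_of_le' h
    rw [liftLower_add_width, Nat.add_le_add_iff_right, Nat.add_le_add_iff_right, le_rowEnd_iff]
  · have := P.liftLower_mono h
    rw [liftLower_width] at this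
    exact iff_of_true (by omega) (by omega)

theorem lt_liftUpper_rowEnd (y : ℕ) : y < P.liftUpper (P.rowEnd y) :=
  (P.rowEnd_lt_iff.1 (Nat.lt_succ_self _)).trans (P.liftLower_succ_lt _)

theorem lt_rowEnd_colTop (x : ℕ) : x < P.rowEnd (P.colTop x) := by
  have := P.liftLower_succ_lt x
  refine Nat.lt_of_succ_le (P.le_rowEnd_iff.2 ?_)
  simp only [colTop, Nat.succ_eq_add_one]
  omega

theorem rowEnd_lt_width {y : ℕ} (hy : y < P.height) : P.rowEnd y < P.width := by
  rwa [rowEnd_lt_iff, liftLower_width]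

theorem rowEnd_add_height_mul (y q : ℕ) :
    P.rowEnd (y + P.height * q) = P.rowEnd y + P.width * q := by
  induction q with
  | zero => simp
  | succ q ih => rw [mul_add, mul_one, ← add_assoc, rowEnd_add_height, ih]; ring

theorem colTop_add_width_mul (x q : ℕ) :
    P.colTop (x + P.width * q) = P.colTop x + P.height * q := by
  induction q with
  | zero => simp
  | succ q ih => rw [mul_add, mul_one, ← add_assoc, colTop_add_width, ih]; ring

theorem rowEnd_mod (y : ℕ) : P.rowEnd y % P.width = P.rowEnd (y % P.height) := by
  conv_lhs => rw [← Nat.mod_add_div y P.height, rowEnd_add_height_mul, Nat.add_mul_mod_self_left]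
  exact Nat.mod_eq_of_lt (P.rowEnd_lt_width (Nat.mod_lt _ P.height_pos))

theorem colTop_mod (x : ℕ) : P.colTop (x % P.width) % P.height = P.colTop x % P.height := by
  conv_rhs => rw [← Nat.mod_add_div x P.width, colTop_add_width_mul, Nat.add_mul_mod_self_left]


/-! ### The parent map and its core. -/

/-- The column of the polyomino below the column `x` of the strip. -/
def modCol (x : ℕ) : Fin P.width := ⟨x % P.width, Nat.mod_lt _ P.width_pos⟩

/-- The row of the PPP containing the row `y` of the strip. -/
def modRow (y : ℕ) : Fin P.height := ⟨y % P.height, Nat.mod_lt _ P.height_pos⟩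

/-- The parent of a vertex. -/
def parent : P.Vertex → P.Vertex
  | .col x => .row (P.modRow (P.colTop x))
  | .row y => .col (P.modCol (P.rowEnd y))

theorem isParent_iff (u v : P.Vertex) : P.IsParent u v ↔ P.parent v = u := by
  rcases u with x | y <;> rcases v with x' | y'
  · simp [IsParent, parent]
  · have h1 := P.rowEnd_lt_width y'.2
    have h2 : P.rowEnd y' % P.width = P.rowEnd y' := Nat.mod_eq_of_lt h1
    have h3 : ∀ x : Fin P.width, (x : ℕ) ≤ P.rowEnd y' ↔ P.lower x ≤ y' := fun x => by
      rw [le_rowEnd_iff, liftLower_coe]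
    simp only [IsParent, parent, Vertex.col.injEq, modCol, Fin.ext_iff, h2,
      ParallelogramPolyomino.IsCell]
    constructor
    · rintro ⟨⟨h4, h5⟩, h6⟩
      by_contra hne
      have h7 := (h3 x).2 h4
      refine h6 ⟨P.rowEnd y', h1⟩ (Fin.lt_def.2 (by simp only; omega)) ⟨(h3 _).1 le_rfl, ?_⟩
      rw [← liftUpper_coe]
      exact P.lt_liftUpper_rowEnd y'
    · intro h4
      refine ⟨⟨(h3 x).1 h4.ge, ?_⟩, fun x' hx' h5 => ?_⟩
      · rw [← liftUpper_coe, ← h4]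
        exact P.lt_liftUpper_rowEnd y'
      · have := (h3 x').2 h5.1
        have := Fin.lt_def.1 hx'
        omega
  · simp only [IsParent, parent, Vertex.row.injEq, modRow, Fin.ext_iff, colTop, liftUpper_coe]
  · simp [IsParent, parent]

instance : Finite P.Vertex :=
  Finite.of_injective
    (fun v => (match v with | .col x => .inl x | .row y => .inr y : Fin P.width ⊕ Fin P.height))
    (by rintro (x | y) (x' | y') h <;> simp_all)

theorem pruned_antitone : Antitone P.pruned := antitone_nat_of_succ_le fun _ _ h => h.1

theorem parent_mem_pruned_succ {m : ℕ} {v : P.Vertex} (hv : v ∈ P.pruned m) :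
    P.parent v ∈ P.pruned (m + 1) := by
  induction m generalizing v with
  | zero => exact ⟨trivial, v, hv, (P.isParent_iff _ _).2 rfl⟩
  | succ m ih => exact ⟨ih hv.1, v, hv, (P.isParent_iff _ _).2 rfl⟩

theorem exists_pruned_eq_core : ∃ m, P.pruned m = P.core ∧ P.pruned (m + 1) = P.core := by
  obtain ⟨m, hm⟩ := WellFoundedLT.antitone_chain_condition P.pruned_antitone
  have h : ∀ k, m ≤ k → P.pruned k = P.core := fun k hk => by
    refine subset_antisymm (Set.subset_iInter fun i => ?_) (Set.iInter_subset _ k)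
    rcases le_total i m with hi | hi
    · exact P.pruned_antitone (hi.trans hk)
    · exact ((hm k hk).symm.trans (hm i hi)).le
  exact ⟨m, h m le_rfl, h (m + 1) (Nat.le_succ m)⟩

theorem parent_mem_core {v : P.Vertex} (hv : v ∈ P.core) : P.parent v ∈ P.core := by
  obtain ⟨m, h1, h2⟩ := P.exists_pruned_eq_core
  rw [← h2]
  exact P.parent_mem_pruned_succ (h1 ▸ hv)

theorem exists_parent_eq {u : P.Vertex} (hu : u ∈ P.core) : ∃ v ∈ P.core, P.parent v = u := by
  obtain ⟨m, h1, h2⟩ := P.exists_pruned_eq_core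
  rw [← h2] at hu
  obtain ⟨-, v, hv, h⟩ := hu
  exact ⟨v, h1 ▸ hv, (P.isParent_iff _ _).1 h⟩

theorem core_nonempty : P.core.Nonempty := by
  obtain ⟨m, h1, -⟩ := P.exists_pruned_eq_core
  rw [← h1]
  clear h1
  induction m with
  | zero => exact ⟨.col P.firstCol, trivial⟩
  | succ m ih => exact ih.imp' P.parent fun _ => P.parent_mem_pruned_succ

/-- Pruning stabilizes after finitely many rounds, so each core vertex has a child in the core; a
surjective self-map of a finite set is injective. -/
theorem parent_injOn_core : Set.InjOn P.parent P.core := by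
  have h1 : Set.MapsTo P.parent P.core P.core := fun _ => P.parent_mem_core
  have h2 : Function.Surjective h1.restrict := by
    rintro ⟨u, hu⟩
    obtain ⟨v, hv, h⟩ := P.exists_parent_eq hu
    exact ⟨⟨v, hv⟩, Subtype.ext h⟩
  exact h1.restrict_inj.1 (Finite.injective_iff_surjective.2 h2)

/-! ### The core lifted to the strip. -/

/-- The column `x` of the strip lies over a column of the trunk. -/
def CoreCol (x : ℕ) : Prop := .col (P.modCol x) ∈ P.core

/-- The row `y` of the strip lies over a row of the trunk. -/
def CoreRow (y : ℕ) : Prop := .row (P.modRow y) ∈ P.core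

theorem modCol_coe (x : Fin P.width) : P.modCol x = x := Fin.ext (Nat.mod_eq_of_lt x.2)

theorem modRow_coe (y : Fin P.height) : P.modRow y = y := Fin.ext (Nat.mod_eq_of_lt y.2)

theorem coreCol_coe (x : Fin P.width) : P.CoreCol x ↔ .col x ∈ P.core := by
  rw [CoreCol, modCol_coe]

theorem coreRow_coe (y : Fin P.height) : P.CoreRow y ↔ .row y ∈ P.core := by
  rw [CoreRow, modRow_coe]

theorem coreCol_periodic : Function.Periodic P.CoreCol P.width := fun x => by
  simp only [CoreCol, modCol, Nat.add_mod_right]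

theorem coreRow_periodic : Function.Periodic P.CoreRow P.height := fun x => by
  simp only [CoreRow, modRow, Nat.add_mod_right]

theorem parent_col (x : ℕ) : P.parent (.col (P.modCol x)) = .row (P.modRow (P.colTop x)) := by
  simp only [parent, modRow, modCol, colTop_mod]

theorem parent_row (y : ℕ) : P.parent (.row (P.modRow y)) = .col (P.modCol (P.rowEnd y)) := by
  simp only [parent, modRow, modCol, ← rowEnd_mod, Nat.mod_mod]

variable {P}

theorem CoreCol.add_width {x : ℕ} (h : P.CoreCol x) : P.CoreCol (x + P.width) := by
  rwa [P.coreCol_periodic x]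

theorem CoreRow.add_height {y : ℕ} (h : P.CoreRow y) : P.CoreRow (y + P.height) := by
  rwa [P.coreRow_periodic y]

theorem CoreCol.colTop {x : ℕ} (h : P.CoreCol x) : P.CoreRow (P.colTop x) := by
  have := P.parent_mem_core h
  rwa [parent_col] at this

theorem CoreRow.rowEnd {y : ℕ} (h : P.CoreRow y) : P.CoreCol (P.rowEnd y) := by
  have := P.parent_mem_core h
  rwa [parent_row] at this

theorem CoreCol.mod_eq {x x' : ℕ} (h : P.CoreCol x) (h' : P.CoreCol x')
    (e : P.colTop x % P.height = P.colTop x' % P.height) : x % P.width = x' % P.width := by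
  have := P.parent_injOn_core h h' (by simp only [parent_col, modRow, e])
  simpa [modCol] using this

theorem CoreRow.mod_eq {y y' : ℕ} (h : P.CoreRow y) (h' : P.CoreRow y')
    (e : P.rowEnd y % P.width = P.rowEnd y' % P.width) : y % P.height = y' % P.height := by
  have := P.parent_injOn_core h h' (by simp only [parent_row, modCol, e])
  simpa [modRow] using this

theorem add_le_of_lt_of_mod_eq {a b n : ℕ} (h : a < b) (e : a % n = b % n) : a + n ≤ b := by
  have h1 : n ∣ b - a := (Nat.modEq_iff_dvd' h.le).1 e
  have := Nat.le_of_dvd (by omega) h1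
  omega

/-- Equal tops would, by injectivity on the core, put the columns at least a full period apart,
where the tops differ by at least the positive height. -/
theorem CoreCol.colTop_lt {x x' : ℕ} (h : P.CoreCol x) (h' : P.CoreCol x') (hlt : x < x') :
    P.colTop x < P.colTop x' := by
  refine (P.colTop_mono hlt.le).lt_of_ne fun e => ?_
  have := P.colTop_mono (add_le_of_lt_of_mod_eq hlt (h.mod_eq h' (by rw [e])))
  rw [colTop_add_width] at this
  have := P.height_pos
  omega

theorem CoreRow.rowEnd_lt {y y' : ℕ} (h : P.CoreRow y) (h' : P.CoreRow y') (hlt : y < y') :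
    P.rowEnd y < P.rowEnd y' := by
  refine (P.rowEnd_mono hlt.le).lt_of_ne fun e => ?_
  have := P.rowEnd_mono (add_le_of_lt_of_mod_eq hlt (h.mod_eq h' (by rw [e])))
  rw [rowEnd_add_height] at this
  have := P.width_pos
  omega

theorem CoreCol.exists_rowEnd_eq {x : ℕ} (h : P.CoreCol x) :
    ∃ y, P.CoreRow y ∧ P.rowEnd y = x := by
  obtain ⟨x' | y, hv, e⟩ := P.exists_parent_eq h
  · simp [parent] at e
  · refine ⟨y + P.height * (x / P.width), ?_, ?_⟩
    · have h1 : P.modRow (y + P.height * (x / P.width)) = P.modRow y :=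
        Fin.ext (Nat.add_mul_mod_self_left _ _ _)
      rwa [CoreRow, h1, modRow_coe]
    · have e' : P.rowEnd y % P.width = x % P.width := by simpa [parent, modCol] using e
      rw [Nat.mod_eq_of_lt (P.rowEnd_lt_width y.2)] at e'
      rw [rowEnd_add_height_mul, e', Nat.mod_add_div]

theorem CoreCol.next {x : ℕ} (h : P.CoreCol x) : P.CoreCol (P.rowEnd (P.colTop x)) :=
  h.colTop.rowEnd

variable (P)

theorem exists_coreCol : ∃ x < P.width, P.CoreCol x := by
  obtain ⟨x | y, h⟩ := P.core_nonempty
  · exact ⟨x, x.2, (P.coreCol_coe x).2 h⟩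
  · exact ⟨P.rowEnd y, P.rowEnd_lt_width y.2, ((P.coreRow_coe y).2 h).rowEnd⟩

open Classical in
/-- The number of columns of the trunk. -/
noncomputable def coreWidth : ℕ := P.width.count P.CoreCol

open Classical in
theorem card_coreCol_Ico (a : ℕ) :
    ((Finset.Ico a (a + P.width)).filter P.CoreCol).card = P.coreWidth :=
  Nat.filter_Ico_card_eq_of_periodic a P.width P.CoreCol P.coreCol_periodic

open Classical in
-- The parent map exchanges rows and columns and is injective on the core, so each kind injects into
-- the other.
theorem card_coreRow_Ico (a : ℕ) :
    ((Finset.Ico a (a + P.height)).filter P.CoreRow).card = P.coreWidth := by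
  rw [Nat.filter_Ico_card_eq_of_periodic a P.height P.CoreRow P.coreRow_periodic, coreWidth,
    Nat.count_eq_card_filter_range, Nat.count_eq_card_filter_range]
  refine le_antisymm ?_ ?_
  · refine Finset.card_le_card_of_injOn (fun y => P.rowEnd y) (fun y hy => ?_)
      fun y hy y' hy' e => ?_
    · simp only [Finset.coe_filter, Finset.mem_range, Set.mem_ofPred_eq] at hy ⊢
      exact ⟨P.rowEnd_lt_width hy.1, hy.2.rowEnd⟩
    · simp only [Finset.coe_filter, Finset.mem_range, Set.mem_ofPred_eq] at hy hy' e
      have := hy.2.mod_eq hy'.2 (by rw [e])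
      rwa [Nat.mod_eq_of_lt hy.1, Nat.mod_eq_of_lt hy'.1] at this
  · refine Finset.card_le_card_of_injOn (fun x => P.colTop x % P.height) (fun x hx => ?_)
      fun x hx x' hx' e => ?_
    · simp only [Finset.coe_filter, Finset.mem_range, Set.mem_ofPred_eq] at hx ⊢
      refine ⟨Nat.mod_lt _ P.height_pos, ?_⟩
      have h1 : P.modRow (P.colTop x % P.height) = P.modRow (P.colTop x) :=
        Fin.ext (Nat.mod_mod _ _)
      rw [CoreRow, h1]
      exact hx.2.colTop
    · simp only [Finset.coe_filter, Finset.mem_range, Set.mem_ofPred_eq] at hx hx' e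
      have := hx.2.mod_eq hx'.2 e
      rwa [Nat.mod_eq_of_lt hx.1, Nat.mod_eq_of_lt hx'.1] at this

theorem coreWidth_pos : 0 < P.coreWidth := by
  classical
  obtain ⟨x, hx, h⟩ := P.exists_coreCol
  rw [← P.card_coreCol_Ico 0, Finset.card_pos]
  exact ⟨x, by simp [hx, h]⟩

theorem next_add_width_mul (x q : ℕ) : P.rowEnd (P.colTop (x + P.width * q)) =
    P.rowEnd (P.colTop x) + P.width * q := by
  rw [colTop_add_width_mul, rowEnd_add_height_mul]

variable {P}

/-- If some column is moved by at most one period, so is every column of the core. -/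
theorem CoreCol.next_le_add_width {x c : ℕ} (hc : P.CoreCol c)
    (hx : P.rowEnd (P.colTop x) ≤ x + P.width) : P.rowEnd (P.colTop c) ≤ c + P.width := by
  by_contra! hlt
  set F : ℕ → ℕ := fun z => P.rowEnd (P.colTop z) with hF
  have hFm : Monotone F := fun _ _ h => P.rowEnd_mono (P.colTop_mono h)
  -- `x + P.width * c` is a translate of `x` lying to the right of `c`; its orbit advances by at
  -- most one period per step and dominates that of `c`.
  have h1 : ∀ k, F^[k] c ≤ x + P.width * c + P.width * k := by
    intro k
    induction k with
    | zero =>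
      have := Nat.le_mul_of_pos_left c P.width_pos
      simp only [Function.iterate_zero, id]
      omega
    | succ k ih =>
      rw [Function.iterate_succ_apply']
      refine (hFm ih).trans ?_
      simp only [hF, next_add_width_mul]
      rw [mul_add]
      omega
  -- Strict monotonicity on the core propagates the strict inequality along the orbit of `c`, which
  -- thus gains at least `P.width + 1` per step and overtakes the bound.
  have h2 : ∀ k, P.CoreCol (F^[k] c) ∧ F^[k] c + P.width < F (F^[k] c) := by
    intro k
    induction k with
    | zero => exact ⟨hc, hlt⟩
    | succ k ih =>
      rw [Function.iterate_succ_apply']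
      refine ⟨ih.1.next, ?_⟩
      have h := ih.1.add_width.colTop.rowEnd_lt ih.1.next.colTop
        (ih.1.add_width.colTop_lt ih.1.next ih.2)
      rwa [colTop_add_width, rowEnd_add_height] at h
  have h3 : ∀ k, P.width * k + k ≤ F^[k] c := by
    intro k
    induction k with
    | zero => simp
    | succ k ih =>
      have := (h2 k).2
      rw [Function.iterate_succ_apply', mul_add]
      omega
  have h4 := h1 (x + P.width * c + 1)
  have h5 := h3 (x + P.width * c + 1)
  omega

theorem next_le_add_width_iff {x : ℕ} :
    P.rowEnd (P.colTop x) ≤ x + P.width ↔ P.liftUpper x ≤ P.liftLower (x + 1) + P.height := by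
  rw [← Nat.lt_succ_iff, Nat.succ_eq_add_one, rowEnd_lt_iff, add_right_comm, liftLower_add_width,
    ← colTop_add_one, Nat.succ_le_iff]

/-! ### Columns, rows and gluing size of the trunk. -/

variable (P)

open Classical in
/-- The columns of the trunk. -/
noncomputable def trunkCols : Finset (Fin P.width) := Finset.univ.filter fun x => P.CoreCol x

open Classical in
/-- The planar rows of the trunk. -/
noncomputable def trunkRows : Finset (Fin P.rows) := Finset.univ.filter fun j =>
  P.CoreRow j ∧ ∃ x : Fin P.width, P.CoreCol x ∧ P.IsCell x j

theorem mem_trunkCols {x : Fin P.width} : x ∈ P.trunkCols ↔ P.CoreCol x := by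
  simp [trunkCols]

theorem mem_trunkRows {j : Fin P.rows} : j ∈ P.trunkRows ↔
    P.CoreRow j ∧ ∃ x : Fin P.width, P.CoreCol x ∧ P.IsCell x j := by
  simp [trunkRows]

theorem coe_trunkCols : (P.trunkCols : Set (Fin P.width)) = {x | Vertex.col x ∈ P.core} :=
  Set.ext fun x => by simp [mem_trunkCols, coreCol_coe]

theorem coe_trunkRows : (P.trunkRows : Set (Fin P.rows)) =
    {j : Fin P.rows | (∃ y : Fin P.height, (j : ℕ) % P.height = y ∧ Vertex.row y ∈ P.core) ∧
      ∃ x : Fin P.width, Vertex.col x ∈ P.core ∧ P.IsCell x j} := by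
  refine Set.ext fun j => ?_
  simp only [Finset.mem_coe, mem_trunkRows, coreCol_coe, Set.mem_ofPred_eq]
  refine and_congr_left fun _ => ⟨fun h => ⟨P.modRow j, rfl, h⟩, fun ⟨y, h1, h2⟩ => ?_⟩
  rwa [CoreRow, show P.modRow j = y from Fin.ext h1]

theorem card_trunkCols : P.trunkCols.card = P.coreWidth := by
  classical
  rw [← P.card_coreCol_Ico 0, trunkCols, zero_add, ← Finset.range_eq_Ico,
    ← Finset.card_map Fin.valEmbedding]
  congr 1
  ext x
  simp only [Finset.mem_map, Finset.mem_filter, Finset.mem_univ, true_and, Fin.valEmbedding_apply,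
    Finset.mem_range]
  exact ⟨fun ⟨a, h, e⟩ => e ▸ ⟨a.2, h⟩, fun ⟨h1, h2⟩ => ⟨⟨x, h1⟩, h2, rfl⟩⟩

theorem ncard_coreRow : {y : Fin P.height | Vertex.row y ∈ P.core}.ncard = P.coreWidth := by
  classical
  rw [← P.card_coreRow_Ico 0, zero_add, ← Finset.range_eq_Ico, ← Set.ncard_coe_finset,
    ← Set.ncard_image_of_injective _ Fin.val_injective]
  congr 1
  ext y
  simp only [Set.mem_image, Set.mem_ofPred_eq, Finset.coe_filter, Finset.mem_range]
  exact ⟨fun ⟨a, h, e⟩ => e ▸ ⟨a.2, (P.coreRow_coe a).2 h⟩,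
    fun ⟨h1, h2⟩ => ⟨⟨y, h1⟩, (P.coreRow_coe ⟨y, h1⟩).1 h2, rfl⟩⟩

theorem trunkCols_nonempty : P.trunkCols.Nonempty :=
  Finset.card_pos.1 (P.card_trunkCols ▸ P.coreWidth_pos)

/-- The first column of the trunk. -/
noncomputable def trunkFirst : Fin P.width := P.trunkCols.min' P.trunkCols_nonempty

/-- The last column of the trunk. -/
noncomputable def trunkLast : Fin P.width := P.trunkCols.max' P.trunkCols_nonempty

theorem coreCol_trunkFirst : P.CoreCol P.trunkFirst :=
  P.mem_trunkCols.1 (Finset.min'_mem _ _)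

theorem coreCol_trunkLast : P.CoreCol P.trunkLast :=
  P.mem_trunkCols.1 (Finset.max'_mem _ _)

variable {P}

theorem CoreCol.trunkFirst_le {x : ℕ} (h : P.CoreCol x) : (P.trunkFirst : ℕ) ≤ x :=
  (Fin.le_def.1 (P.trunkCols.min'_le (P.modCol x)
    (P.mem_trunkCols.2 ((P.coreCol_coe _).2 h)))).trans (Nat.mod_le _ _)

theorem CoreCol.le_trunkLast {x : ℕ} (h : P.CoreCol x) (hx : x < P.width) :
    x ≤ (P.trunkLast : ℕ) :=
  Fin.le_def.1 (P.trunkCols.le_max' ⟨x, hx⟩ (P.mem_trunkCols.2 h))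

variable (P)

theorem trunkFirst_le_trunkLast : (P.trunkFirst : ℕ) ≤ P.trunkLast :=
  P.coreCol_trunkLast.trunkFirst_le

theorem isCell_iff {x : Fin P.width} {y : ℕ} :
    P.IsCell x y ↔ P.liftLower x ≤ y ∧ y < P.liftUpper x := by
  rw [liftLower_coe, liftUpper_coe, ParallelogramPolyomino.IsCell]

/-- For the converse, a core row ends in a core column; if that is not left of the last core column,
the row crosses the latter, being no higher than its top. -/
theorem mem_trunkRows_iff {j : Fin P.rows} : j ∈ P.trunkRows ↔
    P.CoreRow j ∧ P.liftLower P.trunkFirst ≤ j ∧ (j : ℕ) ≤ P.colTop P.trunkLast := by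
  rw [mem_trunkRows]
  refine and_congr_right fun hj => ⟨fun ⟨x, hx, hc⟩ => ?_, fun ⟨h1, h2⟩ => ?_⟩
  · rw [isCell_iff, ← colTop_add_one, Nat.lt_succ_iff] at hc
    exact ⟨(P.liftLower_mono hx.trunkFirst_le).trans hc.1,
      hc.2.trans (P.colTop_mono (hx.le_trunkLast x.2))⟩
  · rcases Nat.lt_or_ge (P.rowEnd j) P.trunkLast with h3 | h3
    · exact ⟨⟨P.rowEnd j, h3.trans P.trunkLast.2⟩, hj.rowEnd, P.isCell_iff.2
        ⟨P.le_rowEnd_iff.1 le_rfl, P.lt_liftUpper_rowEnd j⟩⟩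
    · exact ⟨P.trunkLast, P.coreCol_trunkLast, P.isCell_iff.2
        ⟨P.le_rowEnd_iff.1 h3, by rw [← colTop_add_one]; omega⟩⟩

theorem colTop_lt_rows (x : Fin P.width) : P.colTop x < P.rows := by
  have := P.upper_le_rows x
  rw [← liftUpper_coe, ← colTop_add_one] at this
  omega

open Classical in
theorem card_filter_trunkRows (p : ℕ → Prop) [DecidablePred p] :
    (P.trunkRows.filter fun j : Fin P.rows => p j).card =
      ((Finset.Icc (P.liftLower P.trunkFirst) (P.colTop P.trunkLast)).filter
        fun y => P.CoreRow y ∧ p y).card := by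
  rw [← Finset.card_map Fin.valEmbedding]
  congr 1
  ext y
  simp only [Finset.mem_map, Finset.mem_filter, mem_trunkRows_iff, Fin.valEmbedding_apply,
    Finset.mem_Icc]
  constructor
  · rintro ⟨j, h, rfl⟩
    tauto
  · rintro ⟨h1, h2, h3⟩
    exact ⟨⟨y, h1.2.trans_lt (P.colTop_lt_rows _)⟩, ⟨⟨h2, h1⟩, h3⟩, rfl⟩

open Classical in
-- The interval is shorter than a period, which bounds the count above; the tops of the core columns
-- are distinct core rows in it, which bounds it below.
theorem card_coreRow_Icc_colTop :
    ((Finset.Icc (P.colTop P.trunkFirst) (P.colTop P.trunkLast)).filter P.CoreRow).card =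
      P.coreWidth := by
  refine le_antisymm ?_ ?_
  · rw [← P.card_coreRow_Ico (P.colTop P.trunkFirst)]
    refine Finset.card_le_card (Finset.filter_subset_filter _ fun y hy => ?_)
    rw [Finset.mem_Icc] at hy
    rw [Finset.mem_Ico, ← colTop_add_width]
    refine ⟨hy.1, hy.2.trans_lt (P.coreCol_trunkLast.colTop_lt P.coreCol_trunkFirst.add_width ?_)⟩
    have := P.trunkLast.2
    omega
  · rw [← P.card_trunkCols]
    refine Finset.card_le_card_of_injOn (fun x => P.colTop x) (fun x hx => ?_)
      fun x hx x' hx' e => ?_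
    · rw [Finset.mem_coe, mem_trunkCols] at hx
      simp only [Finset.coe_filter, Finset.mem_Icc, Set.mem_ofPred_eq]
      exact ⟨⟨P.colTop_mono hx.trunkFirst_le, P.colTop_mono (hx.le_trunkLast x.2)⟩, hx.colTop⟩
    · rw [Finset.mem_coe, mem_trunkCols] at hx hx'
      rcases lt_trichotomy (x : ℕ) x' with h | h | h
      · exact absurd e (hx.colTop_lt hx' h).ne
      · exact Fin.ext h
      · exact absurd e (hx'.colTop_lt hx h).ne'

theorem liftLower_trunkFirst_le_colTop : P.liftLower P.trunkFirst ≤ P.colTop P.trunkFirst :=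
  P.le_rowEnd_iff.1 (P.lt_rowEnd_colTop _).le

open Classical in
/-- The gluing size of the trunk. -/
noncomputable def thickness : ℕ :=
  ((Finset.Ico (P.liftLower P.trunkFirst) (P.colTop P.trunkFirst)).filter P.CoreRow).card

theorem card_trunkRows : P.trunkRows.card = P.thickness + P.coreWidth := by
  classical
  have h := P.card_filter_trunkRows fun _ => True
  simp only [Finset.filter_true, and_true] at h
  rw [h, ← P.card_coreRow_Icc_colTop, thickness, ← Finset.card_union_of_disjoint,
    ← Finset.filter_union]
  · congr 2
    ext y
    have := P.liftLower_trunkFirst_le_colTop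
    have := P.colTop_mono P.trunkFirst_le_trunkLast
    simp only [Finset.mem_union, Finset.mem_Icc, Finset.mem_Ico]
    omega
  · refine Finset.disjoint_filter_filter (Finset.disjoint_left.2 fun y => ?_)
    simp only [Finset.mem_Icc, Finset.mem_Ico]
    omega

theorem thickness_pos : 0 < P.thickness := by
  classical
  obtain ⟨y, hy, e⟩ := P.coreCol_trunkFirst.exists_rowEnd_eq
  refine Finset.card_pos.2 ⟨y, ?_⟩
  rw [Finset.mem_filter, Finset.mem_Ico, ← le_rowEnd_iff]
  refine ⟨⟨e.ge, ?_⟩, hy⟩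
  by_contra! h
  have := P.rowEnd_mono h
  have := P.lt_rowEnd_colTop P.trunkFirst
  omega

theorem thickness_le_iff : P.thickness ≤ P.coreWidth ↔
    ∃ x, P.rowEnd (P.colTop x) ≤ x + P.width := by
  classical
  have ha := P.coreCol_trunkFirst
  set a := (P.trunkFirst : ℕ) with ha'
  constructor
  · intro h
    by_contra! hlt
    obtain ⟨y, hy, e⟩ := ha.exists_rowEnd_eq
    have h0 : y + P.height < P.colTop a := by
      by_contra! h1
      have := P.rowEnd_mono h1
      rw [rowEnd_add_height] at this
      have := hlt a
      omega
    have h1 : P.liftLower a ≤ y := P.le_rowEnd_iff.1 e.ge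
    -- A full period of core rows, plus the translate of the core row ending at `a`, lies below the
    -- top of `a`: one row too many.
    have h2 : insert (y + P.height) ((Finset.Ico (P.liftLower a) (P.liftLower a + P.height)).filter
        P.CoreRow) ⊆ (Finset.Ico (P.liftLower a) (P.colTop a)).filter P.CoreRow := by
      intro z
      simp only [Finset.mem_insert, Finset.mem_filter, Finset.mem_Ico]
      rintro (rfl | ⟨h3, h4⟩)
      · exact ⟨⟨by omega, h0⟩, hy.add_height⟩
      · exact ⟨⟨h3.1, by omega⟩, h4⟩
    have h3 := Finset.card_le_card h2
    rw [Finset.card_insert_of_notMem (by simp; omega), card_coreRow_Ico] at h3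
    exact absurd (h3.trans h) (by omega)
  · rintro ⟨x, hx⟩
    have h1 := ha.next_le_add_width hx
    rw [thickness, ← P.card_coreCol_Ico a]
    -- The core rows counted by the thickness end in distinct core columns of `[a, F a)`, which lies
    -- within one period.
    refine Finset.card_le_card_of_injOn (fun y => P.rowEnd y) (fun y hy => ?_)
      fun y hy y' hy' e => ?_
    · simp only [Finset.coe_filter, Finset.mem_Ico, Set.mem_ofPred_eq] at hy ⊢
      exact ⟨⟨P.le_rowEnd_iff.2 hy.1.1, (hy.2.rowEnd_lt ha.colTop hy.1.2).trans_le h1⟩,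
        hy.2.rowEnd⟩
    · simp only [Finset.coe_filter, Finset.mem_Ico, Set.mem_ofPred_eq] at hy hy'
      rcases lt_trichotomy y y' with h | h | h
      · exact absurd e (hy.2.rowEnd_lt hy'.2 h).ne
      · exact h
      · exact absurd e (hy'.2.rowEnd_lt hy.2 h).ne'

variable {P}

theorem ncard_range_of_strictMono {α : Type*} [Preorder α] {n : ℕ} {f : Fin n → α}
    (hf : StrictMono f) : (Set.range f).ncard = n := by
  rw [← Set.image_univ, Set.ncard_image_of_injective, Set.ncard_univ, Nat.card_fin]
  exact hf.injective

theorem IsTrunkOf.width_eq {T : PPP} (h : T.IsTrunkOf P) : T.width = P.coreWidth := by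
  obtain ⟨⟨c, r, hc, hr, hc', hr', -⟩, -⟩ := h
  rw [← ncard_range_of_strictMono hc, hc', ← coe_trunkCols, Set.ncard_coe_finset, card_trunkCols]

/-- All trunks share their width and gluing size, so the existential in `IsPrimitive` can be tested
on any one of them. -/
theorem IsTrunkOf.gluing_eq {T : PPP} (h : T.IsTrunkOf P) : T.gluing = P.thickness := by
  obtain ⟨⟨c, r, hc, hr, hc', hr', -⟩, h⟩ := h
  have h1 : T.rows = P.thickness + P.coreWidth := by
    rw [← ncard_range_of_strictMono hr, hr', ← coe_trunkRows, Set.ncard_coe_finset, card_trunkRows]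
  rw [ncard_coreRow] at h
  have := T.height_add_gluing
  omega

/-! ### Existence of the trunk. -/

variable (P)

theorem lt_card_filter_val_lt_iff {n k : ℕ} (s : Finset (Fin n)) (h : s.card = k) (t : ℕ)
    (j : Fin k) : (j : ℕ) < (s.filter fun i : Fin n => (i : ℕ) < t).card ↔
      (s.orderEmbOfFin h j : ℕ) < t := by
  have h1 : s.filter (fun i : Fin n => (i : ℕ) < t) =
      (Finset.univ.filter fun i => (s.orderEmbOfFin h i : ℕ) < t).map
        (s.orderEmbOfFin h).toEmbedding := by
    conv_lhs => rw [← Finset.map_orderEmbOfFin_univ s h, Finset.filter_map]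
    rfl
  rw [h1, Finset.card_map]
  constructor
  · intro h2
    by_contra! h3
    have h4 : (Finset.univ.filter fun i => (s.orderEmbOfFin h i : ℕ) < t) ⊆ Finset.Iio j :=
      fun i hi => Finset.mem_Iio.2 (lt_of_not_ge fun hij => by
        have := Fin.le_def.1 ((s.orderEmbOfFin h).monotone hij)
        simp only [Finset.mem_filter] at hi
        omega)
    have := Finset.card_le_card h4
    rw [Fin.card_Iio] at this
    omega
  · intro h2
    have h4 : Finset.Iic j ⊆ (Finset.univ.filter fun i => (s.orderEmbOfFin h i : ℕ) < t) :=
      fun i hi => Finset.mem_filter.2 ⟨Finset.mem_univ _, lt_of_le_of_lt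
        (Fin.le_def.1 ((s.orderEmbOfFin h).monotone (Finset.mem_Iic.1 hi))) h2⟩
    have := Finset.card_le_card h4
    rw [Fin.card_Iic] at this
    omega

/-- The increasing enumeration of the columns of the trunk. -/
noncomputable def trunkCol : Fin P.coreWidth ↪o Fin P.width :=
  P.trunkCols.orderEmbOfFin P.card_trunkCols

theorem coreCol_trunkCol (i : Fin P.coreWidth) : P.CoreCol (P.trunkCol i) :=
  P.mem_trunkCols.1 (Finset.orderEmbOfFin_mem _ _ _)

variable {P} in
theorem CoreCol.exists_trunkCol_eq {x : ℕ} (h : P.CoreCol x) (hx : x < P.width) :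
    ∃ i, (P.trunkCol i : ℕ) = x := by
  have h1 : (⟨x, hx⟩ : Fin P.width) ∈ Set.range P.trunkCol := by
    rw [trunkCol, Finset.range_orderEmbOfFin]
    exact P.mem_trunkCols.2 h
  exact h1.imp fun _ e => Fin.ext_iff.1 e

theorem trunkCol_zero : P.trunkCol ⟨0, P.coreWidth_pos⟩ = P.trunkFirst :=
  Finset.orderEmbOfFin_zero _ P.coreWidth_pos

theorem trunkCol_last : P.trunkCol ⟨P.coreWidth - 1, Nat.sub_lt P.coreWidth_pos Nat.one_pos⟩ =
    P.trunkLast :=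
  Finset.orderEmbOfFin_last _ P.coreWidth_pos

/-- The number of planar rows of the trunk below a given level. -/
noncomputable def trunkLevel (t : ℕ) : ℕ :=
  (P.trunkRows.filter fun j : Fin P.rows => (j : ℕ) < t).card

theorem trunkLevel_mono : Monotone P.trunkLevel := fun _ _ h =>
  Finset.card_le_card (Finset.monotone_filter_right _ fun _ _ h' => h'.trans_le h)

theorem trunkLevel_liftLower_trunkFirst : P.trunkLevel (P.liftLower P.trunkFirst) = 0 := by
  rw [trunkLevel, Finset.card_eq_zero, Finset.filter_eq_empty_iff]
  intro j hj
  have := (P.mem_trunkRows_iff.1 hj).2.1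
  omega

theorem trunkLevel_liftUpper_trunkLast :
    P.trunkLevel (P.liftUpper P.trunkLast) = P.trunkRows.card := by
  rw [trunkLevel, Finset.filter_true_of_mem]
  intro j hj
  have := (P.mem_trunkRows_iff.1 hj).2.2
  have := P.colTop_add_one P.trunkLast
  omega

theorem trunkLevel_liftLower_lt {x x' : Fin P.width} (hx : P.CoreCol x)
    (h : (x' : ℕ) ≤ P.rowEnd (P.colTop x)) :
    P.trunkLevel (P.liftLower x') < P.trunkLevel (P.liftUpper x) := by
  have h1 := P.le_rowEnd_iff.1 h
  have h2 := P.colTop_add_one x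
  refine Finset.card_lt_card ⟨Finset.monotone_filter_right _
    fun _ _ h' => h'.trans_le ?_, fun h3 => ?_⟩
  · omega
  · have h4 : (⟨P.colTop x, P.colTop_lt_rows x⟩ : Fin P.rows) ∈ P.trunkRows :=
      P.mem_trunkRows.2 ⟨hx.colTop, x, hx, P.isCell_iff.2
        ⟨P.le_rowEnd_iff.1 (P.lt_rowEnd_colTop x).le, by rw [← h2]; exact Nat.lt_succ_self _⟩⟩
    have h5 := Finset.mem_filter.1 (h3 (Finset.mem_filter.2 ⟨h4, by simp only; omega⟩))
    have := h5.2
    simp only at this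
    omega

/-- The column reached by two parent steps is again in the core and strictly further right, so it
cannot precede the next trunk column. -/
theorem trunkCol_le_next {i j : Fin P.coreWidth} (h : (j : ℕ) ≤ i + 1) :
    (P.trunkCol j : ℕ) ≤ P.rowEnd (P.colTop (P.trunkCol i)) := by
  by_contra! hlt
  obtain ⟨k, hk⟩ := (P.coreCol_trunkCol i).next.exists_trunkCol_eq
    (hlt.trans (P.trunkCol j).2)
  have h1 : i < k := P.trunkCol.lt_iff_lt.1 (Fin.lt_def.2 (hk ▸ P.lt_rowEnd_colTop _))
  have h2 : k < j := P.trunkCol.lt_iff_lt.1 (Fin.lt_def.2 (hk ▸ hlt))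
  simp only [Fin.lt_def] at h1 h2
  omega

theorem thickness_le_trunkLevel : P.thickness ≤ P.trunkLevel (P.liftUpper P.trunkFirst) := by
  classical
  rw [trunkLevel, P.card_filter_trunkRows fun j => j < P.liftUpper P.trunkFirst]
  refine Finset.card_le_card fun y => ?_
  simp only [Finset.mem_filter, Finset.mem_Icc, Finset.mem_Ico]
  rintro ⟨h1, h2⟩
  have := P.colTop_mono P.trunkFirst_le_trunkLast
  have := P.colTop_add_one P.trunkFirst
  exact ⟨by omega, h2, by omega⟩

theorem trunkLevel_le_coreWidth : P.trunkLevel (P.liftLower P.trunkLast) ≤ P.coreWidth := by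
  classical
  rw [trunkLevel, P.card_filter_trunkRows fun j => j < P.liftLower P.trunkLast,
    ← P.card_coreRow_Ico (P.liftLower P.trunkFirst)]
  refine Finset.card_le_card fun y => ?_
  simp only [Finset.mem_filter, Finset.mem_Icc, Finset.mem_Ico]
  rintro ⟨h1, h2, h3⟩
  have h4 : P.liftLower P.trunkLast ≤ P.liftLower (P.trunkFirst + P.width) :=
    P.liftLower_mono (by have := P.trunkLast.2; omega)
  rw [liftLower_add_width] at h4
  exact ⟨by omega, h2⟩

/-- The trunk of a PPP. -/
noncomputable def trunk : PPP where
  width := P.coreWidth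
  rows := P.trunkRows.card
  lower i := P.trunkLevel (P.liftLower (P.trunkCol i))
  upper i := P.trunkLevel (P.liftUpper (P.trunkCol i))
  width_pos := P.coreWidth_pos
  lower_mono _ _ h := P.trunkLevel_mono (P.liftLower_mono (P.trunkCol.monotone h))
  upper_mono _ _ h := P.trunkLevel_mono (P.liftUpper_mono (P.trunkCol.monotone h))
  lower_first := by rw [trunkCol_zero, trunkLevel_liftLower_trunkFirst]
  upper_last := by rw [trunkCol_last, trunkLevel_liftUpper_trunkLast]
  lower_lt_upper i j h := P.trunkLevel_liftLower_lt (P.coreCol_trunkCol i) (P.trunkCol_le_next h)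
  gluing := P.thickness
  gluing_pos := P.thickness_pos
  gluing_le_first := by
    simp only [ParallelogramPolyomino.colHeight, ParallelogramPolyomino.firstCol]
    rw [trunkCol_zero, trunkLevel_liftLower_trunkFirst]
    exact P.thickness_le_trunkLevel
  gluing_le_last := by
    simp only [ParallelogramPolyomino.colHeight, ParallelogramPolyomino.lastCol]
    rw [trunkCol_last, trunkLevel_liftUpper_trunkLast, card_trunkRows]
    have := P.trunkLevel_le_coreWidth
    omega
  not_degenerate h := by
    have h1 : P.thickness = P.trunkRows.card := h.2
    have := P.card_trunkRows
    have := P.coreWidth_pos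
    omega

theorem trunk_isTrunkOf : P.trunk.IsTrunkOf P := by
  refine ⟨⟨P.trunkCol, P.trunkRows.orderEmbOfFin rfl, P.trunkCol.strictMono,
    (P.trunkRows.orderEmbOfFin rfl).strictMono, ?_, ?_, fun x j => ?_⟩, ?_⟩
  · rw [← coe_trunkCols]
    exact Finset.range_orderEmbOfFin _ _
  · rw [← coe_trunkRows]
    exact Finset.range_orderEmbOfFin _ _
  · have h (t : ℕ) := lt_card_filter_val_lt_iff P.trunkRows rfl t j
    change P.trunkLevel _ ≤ _ ∧ _ < P.trunkLevel _ ↔ _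
    rw [isCell_iff, ← not_lt (b := P.liftLower _), ← h, ← h, not_lt]
    rfl
  · rw [ncard_coreRow]
    change P.trunkRows.card - P.thickness = _
    rw [card_trunkRows, Nat.add_sub_cancel_left]

/-! ### Primitivity in terms of the strip boundaries. -/

theorem isPrimitive_iff :
    P.IsPrimitive ↔ ∃ x, P.liftUpper x ≤ P.liftLower (x + 1) + P.height := by
  simp only [← next_le_add_width_iff, ← thickness_le_iff]
  constructor
  · rintro ⟨T, hT, h⟩
    rwa [hT.gluing_eq, hT.width_eq] at h
  · exact fun h => ⟨P.trunk, P.trunk_isTrunkOf, h⟩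

theorem isPrimitive_iff_exists_lt :
    P.IsPrimitive ↔ ∃ x < P.width, P.liftUpper x ≤ P.liftLower (x + 1) + P.height := by
  rw [isPrimitive_iff]
  refine ⟨fun ⟨x, hx⟩ => ⟨x % P.width, Nat.mod_lt _ P.width_pos, ?_⟩, fun ⟨x, _, hx⟩ => ⟨x, hx⟩⟩
  rw [← next_le_add_width_iff] at hx ⊢
  rw [← Nat.mod_add_div x P.width, next_add_width_mul] at hx
  omega

theorem ext_of_lift {P Q : PPP} (hw : P.width = Q.width) (hh : P.height = Q.height)
    (hl : ∀ x < P.width, P.liftLower x = Q.liftLower x)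
    (hu : ∀ x < P.width, P.liftUpper x = Q.liftUpper x) : P = Q := by
  have hr : P.rows = Q.rows := by
    rw [← P.upper_last, ← Q.upper_last, ← liftUpper_coe, ← liftUpper_coe]
    have := hu (P.width - 1) (Nat.sub_lt P.width_pos Nat.one_pos)
    simpa only [← hw] using this
  have hg : P.gluing = Q.gluing := by
    have := P.height_add_gluing
    have := Q.height_add_gluing
    omega
  have hl' : ∀ (x : ℕ) (hx : x < P.width), P.lower ⟨x, hx⟩ = Q.lower ⟨x, hw ▸ hx⟩ := fun x hx => by
    rw [← liftLower_coe, ← liftLower_coe]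
    exact hl x hx
  have hu' : ∀ (x : ℕ) (hx : x < P.width), P.upper ⟨x, hx⟩ = Q.upper ⟨x, hw ▸ hx⟩ := fun x hx => by
    rw [← liftUpper_coe, ← liftUpper_coe]
    exact hu x hx
  clear hl hu hh
  obtain ⟨⟨w, r, l, u⟩, g⟩ := P
  obtain ⟨⟨w', r', l', u'⟩, g'⟩ := Q
  simp only at hw hr hg hl' hu'
  subst hw hr hg
  obtain rfl : l = l' := funext fun x => hl' x x.2
  obtain rfl : u = u' := funext fun x => hu' x x.2
  rfl

/-! ### Coding strips by increments. -/

section Sequences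

/-- Partial sums of a sequence. -/
def psum (α : ℕ →₀ ℕ) (x : ℕ) : ℕ := ∑ i ∈ Finset.range x, α i

theorem psum_zero (α : ℕ →₀ ℕ) : psum α 0 = 0 := Finset.sum_range_zero _

theorem psum_mono (α : ℕ →₀ ℕ) : Monotone (psum α) := fun _ _ h =>
  Finset.sum_le_sum_of_subset (Finset.range_mono h)

theorem psum_eq_of_mem {w h : ℕ} {α : ℕ →₀ ℕ}
    (hα : α ∈ (Finset.range w).finsuppAntidiag h) : psum α w = h :=
  (Finset.mem_finsuppAntidiag.1 hα).1

theorem psum_le_of_mem {w h x : ℕ} {α : ℕ →₀ ℕ}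
    (hα : α ∈ (Finset.range w).finsuppAntidiag h) (hx : x ≤ w) : psum α x ≤ h :=
  (psum_mono α hx).trans_eq (psum_eq_of_mem hα)

theorem eq_of_psum_eq {w h : ℕ} {α β : ℕ →₀ ℕ} (hα : α ∈ (Finset.range w).finsuppAntidiag h)
    (hβ : β ∈ (Finset.range w).finsuppAntidiag h) (e : ∀ x < w, psum α x = psum β x) : α = β := by
  have e' : ∀ x ≤ w, psum α x = psum β x := fun x hx => by
    rcases hx.lt_or_eq with hx | rfl
    · exact e x hx
    · rw [psum_eq_of_mem hα, psum_eq_of_mem hβ]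
  ext i
  by_cases hi : i < w
  · have h1 := e' i hi.le
    have h2 := e' (i + 1) hi
    simp only [psum, Finset.sum_range_succ] at h1 h2
    omega
  · have h3 : ∀ γ ∈ (Finset.range w).finsuppAntidiag h, γ i = 0 := fun γ hγ =>
      Finsupp.notMem_support_iff.1 fun hm =>
        hi (Finset.mem_range.1 ((Finset.mem_finsuppAntidiag.1 hγ).2 hm))
    rw [h3 α hα, h3 β hβ]

/-- The first `w` increments of a sequence. -/
noncomputable def increments (f : ℕ → ℕ) (w : ℕ) : ℕ →₀ ℕ :=
  Finsupp.onFinset (Finset.range w) (fun x => if x < w then f (x + 1) - f x else 0)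
    fun x hx => by
      by_contra h
      simp_all

theorem psum_increments {f : ℕ → ℕ} (hf : Monotone f) {w x : ℕ} (hx : x ≤ w) :
    psum (increments f w) x = f x - f 0 := by
  rw [← Finset.sum_range_tsub hf, psum]
  refine Finset.sum_congr rfl fun i hi => ?_
  rw [increments, Finsupp.onFinset_apply, if_pos ((Finset.mem_range.1 hi).trans_le hx)]

theorem increments_mem {f : ℕ → ℕ} (hf : Monotone f) {w h : ℕ} (e : f w = f 0 + h) :
    increments f w ∈ (Finset.range w).finsuppAntidiag h := by
  refine Finset.mem_finsuppAntidiag.2 ⟨?_, Finsupp.support_onFinset_subset⟩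
  have := psum_increments hf (le_refl w)
  rw [e, Nat.add_sub_cancel_left] at this
  exact this

/-- The largest amount by which the sequence of partial sums of `α`, shifted by one, exceeds that
of `β`. -/
def maxExcess (w : ℕ) (α β : ℕ →₀ ℕ) : ℕ :=
  (Finset.range w).sup fun x => psum α (x + 1) - psum β x

/-- Truncated subtraction does not change the maximum: at `x = w - 1` the difference is `h - psum β
(w - 1)`, which is nonnegative. -/
theorem mem_Ioc_maxExcess_iff {w h e : ℕ} (hw : 0 < w) {α β : ℕ →₀ ℕ}
    (hα : α ∈ (Finset.range w).finsuppAntidiag h) (hβ : β ∈ (Finset.range w).finsuppAntidiag h) :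
    e ∈ Finset.Ioc (maxExcess w α β) (maxExcess w α β + h) ↔
      (∀ x < w, psum α (x + 1) < e + psum β x) ∧
        ∃ x < w, e + psum β x ≤ psum α (x + 1) + h := by
  obtain ⟨z, hz, hz'⟩ := Finset.exists_mem_eq_sup (Finset.range w)
    (Finset.nonempty_range_iff.2 hw.ne') fun x => psum α (x + 1) - psum β x
  have hle : ∀ x < w, psum α (x + 1) - psum β x ≤ maxExcess w α β := fun x hx =>
    Finset.le_sup (f := fun x => psum α (x + 1) - psum β x) (Finset.mem_range.2 hx)
  rw [← maxExcess] at hz'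
  rw [Finset.mem_range] at hz
  have h1 : psum α (w - 1 + 1) = h := by rw [Nat.sub_add_cancel hw, psum_eq_of_mem hα]
  have h2 : psum β (w - 1) ≤ h := psum_le_of_mem hβ (Nat.sub_le w 1)
  have h3 : w - 1 < w := Nat.sub_lt hw Nat.one_pos
  rw [Finset.mem_Ioc]
  constructor
  · rintro ⟨h4, h5⟩
    refine ⟨fun x hx => ?_, ?_⟩
    · have := hle x hx
      omega
    · rcases le_total (psum β z) (psum α (z + 1)) with h6 | h6
      · exact ⟨z, hz, by omega⟩
      -- Here the truncated maximum is `0`, so the last column attains it as well.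
      · exact ⟨w - 1, h3, by omega⟩
  · rintro ⟨h4, x, hx, h5⟩
    have h6 := h4 z hz
    have h7 := h4 (w - 1) h3
    have h8 := hle x hx
    omega

/-- The codes of primitive PPPs of width `w` and height `h`: the increments of the two boundaries
of the strip and the height of the first East step of the upper boundary. -/
def codes (w h : ℕ) : Finset ((_ : (ℕ →₀ ℕ) × (ℕ →₀ ℕ)) × ℕ) :=
  ((Finset.range w).finsuppAntidiag h ×ˢ (Finset.range w).finsuppAntidiag h).sigma
    fun p => Finset.Ioc (maxExcess w p.1 p.2) (maxExcess w p.1 p.2 + h)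

theorem card_codes (w h : ℕ) : (codes w h).card = h * (w + h - 1).choose h ^ 2 := by
  rw [codes, Finset.card_sigma, Finset.sum_const_nat (m := h) fun p _ => by simp,
    Finset.card_product, Finset.card_finsuppAntidiag_nat_eq_choose, Finset.card_range]
  ring

theorem mem_codes_iff {w h : ℕ} (hw : 0 < w) {p : (_ : (ℕ →₀ ℕ) × (ℕ →₀ ℕ)) × ℕ} :
    p ∈ codes w h ↔ (p.1.1 ∈ (Finset.range w).finsuppAntidiag h ∧
      p.1.2 ∈ (Finset.range w).finsuppAntidiag h) ∧
      (∀ x < w, psum p.1.1 (x + 1) < p.2 + psum p.1.2 x) ∧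
        ∃ x < w, p.2 + psum p.1.2 x ≤ psum p.1.1 (x + 1) + h := by
  rw [codes, Finset.mem_sigma, Finset.mem_product]
  exact and_congr_right fun hp => mem_Ioc_maxExcess_iff hw hp.1 hp.2

end Sequences

/-! ### From codes back to primitive PPPs. -/

/-- The PPP with given increments of the two boundaries of its strip, and with given height of the
first East step of the upper boundary. -/
def ofIncrements {w h : ℕ} (hw : 0 < w) (hh : 0 < h) {α β : ℕ →₀ ℕ} {e : ℕ}
    (hα : α ∈ (Finset.range w).finsuppAntidiag h) (hβ : β ∈ (Finset.range w).finsuppAntidiag h)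
    (hlt : ∀ x < w, psum α (x + 1) < e + psum β x) : PPP where
  width := w
  rows := e + psum β (w - 1)
  lower x := psum α x
  upper x := e + psum β x
  width_pos := hw
  lower_mono _ _ h := psum_mono α (Fin.le_def.1 h)
  upper_mono _ _ h := Nat.add_le_add_left (psum_mono β (Fin.le_def.1 h)) e
  lower_first := psum_zero α
  upper_last := rfl
  lower_lt_upper i j h := (psum_mono α h).trans_lt (hlt i i.2)
  gluing := e + psum β (w - 1) - h
  gluing_pos := by
    have := hlt (w - 1) (Nat.sub_lt hw Nat.one_pos)
    rw [Nat.sub_add_cancel hw, psum_eq_of_mem hα] at this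
    omega
  gluing_le_first := by
    have := psum_le_of_mem hβ (Nat.sub_le w 1)
    simp only [ParallelogramPolyomino.colHeight, ParallelogramPolyomino.firstCol, psum_zero]
    omega
  gluing_le_last := by
    have := psum_le_of_mem hα (Nat.sub_le w 1)
    simp only [ParallelogramPolyomino.colHeight, ParallelogramPolyomino.lastCol]
    omega
  not_degenerate hd := by
    have := hlt (w - 1) (Nat.sub_lt hw Nat.one_pos)
    rw [Nat.sub_add_cancel hw, psum_eq_of_mem hα] at this
    have : e + psum β (w - 1) - h = e + psum β (w - 1) := hd.2
    omega

section OfIncrements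

variable {w h : ℕ} (hw : 0 < w) (hh : 0 < h) {α β : ℕ →₀ ℕ} {e : ℕ}
    (hα : α ∈ (Finset.range w).finsuppAntidiag h) (hβ : β ∈ (Finset.range w).finsuppAntidiag h)
    (hlt : ∀ x < w, psum α (x + 1) < e + psum β x)

theorem width_ofIncrements : (ofIncrements hw hh hα hβ hlt).width = w := rfl

theorem height_ofIncrements : (ofIncrements hw hh hα hβ hlt).height = h := by
  have := hlt (w - 1) (Nat.sub_lt hw Nat.one_pos)
  rw [Nat.sub_add_cancel hw, psum_eq_of_mem hα] at this
  simp only [height, ofIncrements]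
  omega

theorem liftLower_ofIncrements {x : ℕ} (hx : x ≤ w) :
    (ofIncrements hw hh hα hβ hlt).liftLower x = psum α x := by
  rcases hx.lt_or_eq with hx | rfl
  · exact (ofIncrements hw hh hα hβ hlt).liftLower_coe ⟨x, hx⟩
  · rw [psum_eq_of_mem hα]
    exact (liftLower_width _).trans (height_ofIncrements hw hh hα hβ hlt)

theorem liftUpper_ofIncrements {x : ℕ} (hx : x < w) :
    (ofIncrements hw hh hα hβ hlt).liftUpper x = e + psum β x :=
  (ofIncrements hw hh hα hβ hlt).liftUpper_coe ⟨x, hx⟩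

theorem isPrimitive_ofIncrements : (ofIncrements hw hh hα hβ hlt).IsPrimitive ↔
    ∃ x < w, e + psum β x ≤ psum α (x + 1) + h := by
  rw [isPrimitive_iff_exists_lt, height_ofIncrements, width_ofIncrements]
  refine exists_congr fun x => and_congr_right fun hx => ?_
  rw [liftUpper_ofIncrements hw hh hα hβ hlt hx, liftLower_ofIncrements hw hh hα hβ hlt hx]

end OfIncrements

theorem ncard_isPrimitive_width_height {w h : ℕ} (hw : 0 < w) (hh : 0 < h) :
    {P : PPP | P.IsPrimitive ∧ P.width = w ∧ P.height = h}.ncard =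
      h * (w + h - 1).choose h ^ 2 := by
  rw [← card_codes, ← Set.ncard_coe_finset]
  symm
  refine Set.ncard_congr (fun p hp =>
    ofIncrements hw hh ((mem_codes_iff hw).1 hp).1.1 ((mem_codes_iff hw).1 hp).1.2
      ((mem_codes_iff hw).1 hp).2.1) (fun p hp => ?_) (fun p q hp hq e => ?_) fun P hP => ?_
  · exact ⟨(isPrimitive_ofIncrements ..).2 ((mem_codes_iff hw).1 hp).2.2,
      width_ofIncrements .., height_ofIncrements ..⟩
  · obtain ⟨⟨hα, hβ⟩, hlt, -⟩ := (mem_codes_iff hw).1 hp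
    obtain ⟨⟨hα', hβ'⟩, hlt', -⟩ := (mem_codes_iff hw).1 hq
    obtain ⟨⟨α, β⟩, a⟩ := p
    obtain ⟨⟨α', β'⟩, a'⟩ := q
    have h1 : ∀ x < w, psum α x = psum α' x := fun x hx => by
      rw [← liftLower_ofIncrements hw hh hα hβ hlt hx.le,
        ← liftLower_ofIncrements hw hh hα' hβ' hlt' hx.le]
      exact congrArg (fun Q : PPP => Q.liftLower x) e
    have h2 : ∀ x < w, a + psum β x = a' + psum β' x := fun x hx => by
      rw [← liftUpper_ofIncrements hw hh hα hβ hlt hx,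
        ← liftUpper_ofIncrements hw hh hα' hβ' hlt' hx]
      exact congrArg (fun Q : PPP => Q.liftUpper x) e
    obtain rfl := eq_of_psum_eq hα hα' h1
    obtain rfl : a = a' := by simpa only [psum_zero, add_zero] using h2 0 hw
    obtain rfl := eq_of_psum_eq hβ hβ' fun x hx => Nat.add_left_cancel (h2 x hx)
    rfl
  · obtain ⟨hp, rfl, rfl⟩ := hP
    have hα : increments P.liftLower P.width ∈ (Finset.range P.width).finsuppAntidiag P.height :=
      increments_mem P.liftLower_mono (by rw [liftLower_width, liftLower_zero, zero_add])
    have hβ : increments P.liftUpper P.width ∈ (Finset.range P.width).finsuppAntidiag P.height :=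
      increments_mem P.liftUpper_mono (by simpa using P.liftUpper_add_width 0)
    have h1 : ∀ x ≤ P.width, psum (increments P.liftLower P.width) x = P.liftLower x :=
      fun x hx => by rw [psum_increments P.liftLower_mono hx, liftLower_zero, Nat.sub_zero]
    have h2 : ∀ x ≤ P.width, P.liftUpper 0 + psum (increments P.liftUpper P.width) x =
        P.liftUpper x := fun x hx => by
      rw [psum_increments P.liftUpper_mono hx, Nat.add_sub_cancel' (P.liftUpper_mono x.zero_le)]
    refine ⟨⟨(increments P.liftLower P.width, increments P.liftUpper P.width), P.liftUpper 0⟩,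
      (mem_codes_iff hw).2 ⟨⟨hα, hβ⟩, fun x hx => ?_, ?_⟩, ext_of_lift rfl ?_ (fun x hx => ?_)
      fun x hx => ?_⟩
    · rw [h1 _ hx, h2 _ hx.le]
      exact P.liftLower_succ_lt x
    · refine (P.isPrimitive_iff_exists_lt.1 hp).imp fun x hx => ⟨hx.1, ?_⟩
      rw [h1 _ hx.1, h2 _ hx.1.le]
      exact hx.2
    · rw [height_ofIncrements]
    · exact (liftLower_ofIncrements _ _ _ _ _ hx.le).trans (h1 x hx.le)
    · exact (liftUpper_ofIncrements _ _ _ _ _ hx).trans (h2 x hx.le)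

/-- An infinite set has `ncard` zero, so the positive count already gives finiteness. -/
theorem finite_isPrimitive_width_height {w h : ℕ} (hw : 0 < w) (hh : 0 < h) :
    {P : PPP | P.IsPrimitive ∧ P.width = w ∧ P.height = h}.Finite := by
  refine Set.finite_of_ncard_pos ?_
  rw [ncard_isPrimitive_width_height hw hh]
  have := Nat.choose_pos (n := w + h - 1) (k := h) (by omega)
  positivity

/-! ### Summation over widths and heights. -/

theorem finite_isPrimitive (n : ℕ) : {P : PPP | P.IsPrimitive ∧ P.semiPerimeter = n}.Finite := by
  refine ((Finset.HasAntidiagonal.antidiagonal n).finite_toSet.biUnion (t := fun p =>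
    {P : PPP | P.IsPrimitive ∧ P.width = p.1 ∧ P.height = p.2}) fun p _ => ?_).subset
    fun P hP => Set.mem_biUnion (x := (P.width, P.height))
      (Finset.HasAntidiagonal.mem_antidiagonal.2 hP.2) ⟨hP.1, rfl, rfl⟩
  by_cases h : 0 < p.1 ∧ 0 < p.2
  · exact finite_isPrimitive_width_height h.1 h.2
  · refine Set.finite_empty.subset fun P hP => h ?_
    rw [← hP.2.1, ← hP.2.2]
    exact ⟨P.width_pos, P.height_pos⟩

theorem ncard_isPrimitive_eq_sum (n : ℕ) :
    {P : PPP | P.IsPrimitive ∧ P.semiPerimeter = n}.ncard = ∑ p ∈ Finset.HasAntidiagonal.antidiagonal n,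
      {P : PPP | P.IsPrimitive ∧ P.width = p.1 ∧ P.height = p.2}.ncard := by
  classical
  have hf := finite_isPrimitive n
  rw [Set.ncard_eq_toFinset_card _ hf, Finset.card_eq_sum_card_fiberwise
    (f := fun P : PPP => (P.width, P.height)) (t := Finset.HasAntidiagonal.antidiagonal n)
    fun P hP => Finset.mem_coe.2 (Finset.HasAntidiagonal.mem_antidiagonal.2 (hf.mem_toFinset.1 hP).2)]
  refine Finset.sum_congr rfl fun p hp => ?_
  rw [← Set.ncard_coe_finset]
  congr 1
  ext P
  rw [Finset.HasAntidiagonal.mem_antidiagonal] at hp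
  simp only [Finset.coe_filter, Set.Finite.mem_toFinset, Set.mem_ofPred_eq, semiPerimeter,
    Prod.ext_iff]
  exact ⟨fun h => ⟨h.1.1, h.2⟩, fun h => ⟨⟨h.1, by rw [h.2.1, h.2.2, hp]⟩, h.2⟩⟩

theorem ncard_isPrimitive_width_zero (h : ℕ) :
    {P : PPP | P.IsPrimitive ∧ P.width = 0 ∧ P.height = h}.ncard = 0 := by
  convert Set.ncard_empty PPP
  exact Set.eq_empty_of_forall_notMem fun P hP => P.width_pos.ne' hP.2.1

theorem ncard_isPrimitive_height_zero (w : ℕ) :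
    {P : PPP | P.IsPrimitive ∧ P.width = w ∧ P.height = 0}.ncard = 0 := by
  convert Set.ncard_empty PPP
  exact Set.eq_empty_of_forall_notMem fun P hP => P.height_pos.ne' hP.2.2

/-- Absorption turns `(k + 1) * (n + 1).choose (k + 1)` into `(n + 1) * n.choose k`; symmetry of the
other factor leaves Vandermonde's convolution. -/
theorem sum_antidiagonal_mul_choose_sq (n : ℕ) :
    ∑ p ∈ Finset.HasAntidiagonal.antidiagonal n, (p.2 + 1) * (n + 1).choose (p.2 + 1) ^ 2 =
      (n + 1) * (2 * n + 1).choose n := by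
  rw [show 2 * n + 1 = n + 1 + n by ring, Nat.add_choose_eq, Finset.mul_sum]
  refine Finset.sum_congr rfl fun p hp => ?_
  rw [Finset.HasAntidiagonal.mem_antidiagonal] at hp
  have h1 : (n + 1).choose (p.2 + 1) = (n + 1).choose p.1 :=
    Nat.choose_symm_of_eq_add (by omega)
  have h2 := Nat.add_one_mul_choose_eq n p.2
  rw [h1] at h2 ⊢
  rw [mul_comm ((n + 1).choose p.1) (n.choose p.2), ← mul_assoc, h2]
  ring

theorem ncard_isPrimitive_semiPerimeter (n : ℕ) :
    {P : PPP | P.IsPrimitive ∧ P.semiPerimeter = n + 2}.ncard =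
      (n + 1) * (2 * n + 1).choose n := by
  rw [ncard_isPrimitive_eq_sum, Finset.Nat.antidiagonal_succ_succ',
    ← sum_antidiagonal_mul_choose_sq]
  simp only [Finset.sum_cons, Finset.sum_map, ncard_isPrimitive_width_zero,
    ncard_isPrimitive_height_zero, zero_add]
  refine Finset.sum_congr rfl fun p hp => ?_
  rw [Finset.HasAntidiagonal.mem_antidiagonal] at hp
  simp only [Function.Embedding.coe_prodMap, Function.Embedding.coeFn_mk, Prod.map_fst,
    Prod.map_snd, Nat.succ_eq_add_one]
  rw [ncard_isPrimitive_width_height (Nat.succ_pos _) (Nat.succ_pos _)]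
  congr 3
  omega

theorem ncard_isPrimitive_eq_zero {n : ℕ} (hn : n < 2) :
    {P : PPP | P.IsPrimitive ∧ P.semiPerimeter = n}.ncard = 0 := by
  convert Set.ncard_empty PPP
  refine Set.eq_empty_of_forall_notMem ?_
  rintro P ⟨-, hP⟩
  have := P.width_pos
  have := P.height_pos
  simp only [semiPerimeter] at hP
  omega

end PPP

/-! ### Closed form and generating series. -/

theorem add_one_mul_choose_eq_factorial_div (n : ℕ) :
    (((n + 1) * (2 * n + 1).choose n : ℕ) : ℚ) =
      (Nat.factorial (2 * n + 1) : ℚ) / (Nat.factorial n : ℚ) ^ 2 := by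
  have h := Nat.add_choose_mul_factorial_mul_factorial n (n + 1)
  have h0 := Nat.factorial_ne_zero n
  rw [eq_div_iff (by positivity), ← Nat.choose_symm_half, show 2 * n + 1 = n + (n + 1) by ring, ← h, Nat.factorial_succ]
  push_cast
  ring

/-- Both sides equal `1` at `n = 0` and have consecutive ratio `(4 * n + 6) / (n + 1)`. -/
theorem neg_four_pow_mul_choose (n : ℕ) : (-4 : ℚ) ^ n * Ring.choose (-3 / 2 : ℚ) n =
    (Nat.factorial (2 * n + 1) : ℚ) / (Nat.factorial n : ℚ) ^ 2 := by
  induction n with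
  | zero => simp
  | succ n ih =>
    have h1 : ((n : ℚ) + 1) * Ring.choose (-3 / 2 : ℚ) (n + 1) =
        (-3 / 2 - n) * Ring.choose (-3 / 2 : ℚ) n := by
      have := Ring.choose_smul_choose (-3 / 2 : ℚ) (Nat.le_succ n)
      simp only [Nat.succ_eq_add_one, Nat.choose_succ_self_right, Nat.add_sub_cancel_left,
        Ring.choose_one_right, nsmul_eq_mul] at this
      push_cast at this
      rw [this, mul_comm]
    have h0 : (Nat.factorial n : ℚ) ≠ 0 := by positivity
    have hn : (n : ℚ) + 1 ≠ 0 := by positivity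
    have h2 : Ring.choose (-3 / 2 : ℚ) (n + 1) =
        (-3 / 2 - n) * Ring.choose (-3 / 2 : ℚ) n / (n + 1) := by
      rw [eq_div_iff hn, ← h1]; ring
    have h3 : (-4 : ℚ) ^ (n + 1) * Ring.choose (-3 / 2 : ℚ) (n + 1) =
        (4 * n + 6) / (n + 1) * ((-4 : ℚ) ^ n * Ring.choose (-3 / 2 : ℚ) n) := by
      rw [h2, pow_succ]; field_simp; ring
    rw [h3, ih, show 2 * (n + 1) + 1 = 2 * n + 1 + 1 + 1 by ring, Nat.factorial_succ (2 * n + 1 + 1),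
      Nat.factorial_succ (2 * n + 1), Nat.factorial_succ n]
    push_cast
    field_simp
    ring

theorem mainTheorem1 :
    (∀ n : ℕ, {P : PPP | P.IsPrimitive ∧ P.semiPerimeter = n}.Finite) ∧
    (∀ n : ℕ, ({P : PPP | P.IsPrimitive ∧ P.semiPerimeter = n + 2}.ncard : ℚ) =
      (Nat.factorial (2 * n + 1) : ℚ) / (Nat.factorial n : ℚ) ^ 2) ∧
    (PowerSeries.mk fun n : ℕ =>
        ({P : PPP | P.IsPrimitive ∧ P.semiPerimeter = n}.ncard : ℚ)) =
      PowerSeries.X ^ 2 *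
        PowerSeries.rescale (-4 : ℚ) (PowerSeries.binomialSeries ℚ (-3 / 2 : ℚ)) := by
  have h (n : ℕ) : ({P : PPP | P.IsPrimitive ∧ P.semiPerimeter = n + 2}.ncard : ℚ) =
      (Nat.factorial (2 * n + 1) : ℚ) / (Nat.factorial n : ℚ) ^ 2 := by
    rw [PPP.ncard_isPrimitive_semiPerimeter, add_one_mul_choose_eq_factorial_div]
  refine ⟨PPP.finite_isPrimitive, h, PowerSeries.ext fun n => ?_⟩
  rw [PowerSeries.coeff_mk, PowerSeries.coeff_X_pow_mul']
  split_ifs with hn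
  · obtain ⟨m, rfl⟩ := Nat.exists_eq_add_of_le' hn
    rw [h, Nat.add_sub_cancel, PowerSeries.coeff_rescale, PowerSeries.binomialSeries_coeff,
      smul_eq_mul, mul_one, neg_four_pow_mul_choose]
  · rw [PPP.ncard_isPrimitive_eq_zero (not_le.1 hn), Nat.cast_zero]
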